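/- A \emph{plane map} is a proper embedding of a finite connected graph (loops and multiple edges allowed) in the plane, up to orientation-preserving homeomorphism, or equivalently in the sphere with one distinguished face, the \emph{outer face}. For an integer $k\ge 1$, a \emph{$k$-fractional orientation} assigns to each edge $k$ units of direction, distributed between its two directions ($k=1$ is an ordinary orientation). An edge is \emph{saturated} if all its $k$ units point in the same direction. An oriented path or cycle is one in which every edge carries at least one unit in the direction of traversal. A simple cycle with a direction of traversal is \emph{clockwise} (resp. \emph{counterclockwise}) if the outer face is on its left (resp. on its right). The orientation is \emph{minimal} if it has no counterclockwise simple oriented cycle (going back and forth along one edge is not a cycle). For a map with a distinguished \emph{root face}, the orientation is \emph{accessible} if from every vertex there is an oriented path to some vertex incident to the root face. A \emph{cyclic forest} is a face-rooted plane map with exactly two faces, the root face and the outer face, in which the border of the root face is a simple cycle. Let $M$ be a face-rooted plane map whose root face differs from its outer face, endowed with a minimal accessible $k$-fractional orientation $O$, for some $k\ge1$. Suppose that the contour of the root face is a simple cycle and that it is an oriented cycle of $O$ (in one of its two directions). Then there is a unique partition of the edges of $M$ into two (possibly empty) parts $(T,C)$ such that: \begin{itemize} \item the edges in $T$ form a spanning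 cyclic forest of $M$ with the same root face as $M$, on which the restriction of $O$ is accessible; \item every edge in $C$ is saturated, and turns clockwise around the cycle it forms with edges in $T$: every simple cycle consisting of this edge and of edges in $T$, traversed in the direction of the edge, is clockwise. (This cycle is unique, except that it may use either of two arcs of the cycle of $T$ when it meets that cycle in at least two vertices.) \end{itemize} -/

import Mathlib

/-- A planar map: a connected graph (loops and multiple edges are allowed) embedded in the oriented
sphere, up to orientation-preserving homeomorphism, encoded as a combinatorial map on the type `D`
of its darts (half-edges; each edge consists of two opposite darts). `rot d` is the dart following
`d` in counterclockwise order around the vertex from which `d` issues. -/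
structure PlanarMap (D : Type*) where
  rot : Equiv.Perm D
  opp : Equiv.Perm D
  opp_opp : ∀ d, opp (opp d) = d
  opp_ne : ∀ d, opp d ≠ d
  /-- The underlying graph is connected. -/
  connected : ∀ a b : D, ∃ g ∈ Subgroup.closure {rot, opp}, g a = b
  /-- Euler's formula `V + F = E + 2`: the underlying surface is the sphere. The faces are the
  cycles of `rot⁻¹ * opp`. -/
  euler : Nat.card (Quotient (Equiv.Perm.SameCycle.setoid rot)) +
      Nat.card (Quotient (Equiv.Perm.SameCycle.setoid (rot⁻¹ * opp))) =
    Nat.card (Quotient (Equiv.Perm.SameCycle.setoid opp)) + 2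

namespace PlanarMap

variable {D : Type*} (M : PlanarMap D)

/-- The next dart along the contour of the face on the left of a dart: follow the dart, then take
the next dart in clockwise order around its end. -/
def faceNext : Equiv.Perm D := M.rot⁻¹ * M.opp

/-- Vertices. -/
def Vertex : Type _ := Quotient (Equiv.Perm.SameCycle.setoid M.rot)

/-- Edges. -/
def Edge : Type _ := Quotient (Equiv.Perm.SameCycle.setoid M.opp)

/-- Faces. -/
def Face : Type _ := Quotient (Equiv.Perm.SameCycle.setoid M.faceNext)

/-- The vertex from which a dart issues. -/
def src (d : D) : M.Vertex := Quotient.mk (Equiv.Perm.SameCycle.setoid M.rot) d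

/-- The vertex to which a dart points. -/
def tgt (d : D) : M.Vertex := M.src (M.opp d)

/-- The edge containing a dart. -/
def edge (d : D) : M.Edge := Quotient.mk (Equiv.Perm.SameCycle.setoid M.opp) d

/-- The face on the left of a dart. -/
def left (d : D) : M.Face := Quotient.mk (Equiv.Perm.SameCycle.setoid M.faceNext) d

/-- The face on the right of a dart. -/
def right (d : D) : M.Face := M.left (M.opp d)

/-! ### Cycles and their sides -/

/-- `c 0, c 1, …, c n` are the successive darts of a simple cycle (indices are cyclic): no vertex
and no edge is repeated. A loop is a simple cycle of length one. -/
structure IsSimpleCycle {n : ℕ} (c : Fin (n + 1) → D) : Prop where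
  chain : ∀ i, M.tgt (c i) = M.src (c (i + 1))
  src_injective : Function.Injective fun i => M.src (c i)
  edge_injective : Function.Injective fun i => M.edge (c i)

/-- Two faces are adjacent across an edge that does not belong to `S`. -/
def AdjOff (S : Set M.Edge) (f g : M.Face) : Prop :=
  ∃ d, M.edge d ∉ S ∧ M.left d = f ∧ M.right d = g

/-- The faces `f` and `g` lie in the same connected component of the complement of the union of
the vertices and of the edges in `S`, when `S` is the edge set of a connected spanning subgraph
or of a cycle. -/
def SameRegion (S : Set M.Edge) (f g : M.Face) : Prop :=
  Relation.ReflTransGen (M.AdjOff S) f g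

/-- The face `f` is on the left of the simple cycle `c`. -/
def IsLeftOf {n : ℕ} (c : Fin (n + 1) → D) (f : M.Face) : Prop :=
  ∃ i, M.SameRegion (Set.range fun j => M.edge (c j)) (M.left (c i)) f

/-- The face `f` is on the right of the simple cycle `c`. -/
def IsRightOf {n : ℕ} (c : Fin (n + 1) → D) (f : M.Face) : Prop :=
  ∃ i, M.SameRegion (Set.range fun j => M.edge (c j)) (M.right (c i)) f

/-! ### Fractional orientations -/

/-- A `k`-fractional orientation: `O.flow d` of the `k` copies of the edge containing `d` are
directed along `d`, the others along the opposite dart. For `k = 1` this is an orientation. -/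
structure FracOrientation (k : ℕ) where
  flow : D → ℕ
  flow_add : ∀ d, flow d + flow (M.opp d) = k

variable {M} {k : ℕ}

/-- There is an edge in `S` joining `u` to `v` that is at least partially oriented from `u`
to `v`. -/
def FracOrientation.Step (O : M.FracOrientation k) (S : Set M.Edge) (u v : M.Vertex) : Prop :=
  ∃ d, M.edge d ∈ S ∧ 0 < O.flow d ∧ M.src d = u ∧ M.tgt d = v

/-- The restriction of `O` to the edges in `S` is accessible for the root face `root`: from every
vertex there is an oriented path with edges in `S` to a vertex incident to `root`. -/
def FracOrientation.AccessibleOn (O : M.FracOrientation k) (root : M.Face) (S : Set M.Edge) :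
    Prop :=
  ∀ v, ∃ d, M.left d = root ∧ Relation.ReflTransGen (O.Step S) v (M.src d)

/-- Every edge of `c` is at least partially oriented in the direction of `c`. -/
def FracOrientation.IsOriented (O : M.FracOrientation k) {n : ℕ} (c : Fin (n + 1) → D) : Prop :=
  ∀ i, 0 < O.flow (c i)

/-- `O` is minimal with respect to the outer face `outer`: there is no counterclockwise cycle, that
is, no simple oriented cycle with the outer face on its right. -/
def FracOrientation.Minimal (O : M.FracOrientation k) (outer : M.Face) : Prop :=
  ∀ (n : ℕ) (c : Fin (n + 1) → D), M.IsSimpleCycle c → O.IsOriented c → ¬ M.IsRightOf c outer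

/-- The contour of the face `f` is a simple cycle, and this cycle is an oriented cycle of `O`
(in one direction or the other). -/
def FracOrientation.ContourIsCircuit (O : M.FracOrientation k) (f : M.Face) : Prop :=
  ∃ (n : ℕ) (c : Fin (n + 1) → D), M.IsSimpleCycle c ∧ (∀ d, M.left d = f ↔ d ∈ Set.range c) ∧
    (O.IsOriented c ∨ O.IsOriented fun i => M.opp (c i))

/-! ### Cyclic forests and the partition -/

variable (M)

/-- The edges in `T` form a spanning cyclic forest of the plane map `M` with outer face `outer`,
with the same root face `root` as `M`. -/
structure IsSpanningCyclicForest (root outer : M.Face) (T : Set M.Edge) : Prop where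
  /-- `T` forms a connected spanning submap of `M`. -/
  connected : ∀ u v, Relation.ReflTransGen
    (fun x y => ∃ d, M.edge d ∈ T ∧ M.src d = x ∧ M.tgt d = y) u v
  /-- The submap has at most two faces, the one containing `root` and the one containing
  `outer`. -/
  two_faces : ∀ f, M.SameRegion T root f ∨ M.SameRegion T outer f
  /-- These two faces are distinct. -/
  root_ne_outer : ¬ M.SameRegion T root outer
  /-- The root face of the submap is the root face of `M`. -/
  same_root : ∀ f, M.SameRegion T root f → f = root
  /-- The border of the root face of the submap is a simple cycle: the darts of the submap with
  this face on their left are those of a simple cycle. -/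
  border : ∃ (n : ℕ) (c : Fin (n + 1) → D), M.IsSimpleCycle c ∧
    ∀ d, (M.edge d ∈ T ∧ M.SameRegion T root (M.left d)) ↔ d ∈ Set.range c

variable {M}

/-- The edge `e` is saturated, and in its direction it turns clockwise around the cycle that it
forms with edges in `T`: this cycle, traversed in the direction of `e`, has the outer face on its
left. When `T` is a cyclic forest, the cycle is unique except that, if it meets the cycle of `T` in
at least two vertices, it may follow either of two arcs of the latter; both choices are
required to be clockwise. -/
def FracOrientation.IsClosureEdge (O : M.FracOrientation k) (outer : M.Face) (T : Set M.Edge)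
    (e : M.Edge) : Prop :=
  ∃ d, M.edge d = e ∧ O.flow d = k ∧
    ∀ (n : ℕ) (c : Fin (n + 1) → D), M.IsSimpleCycle c → c 0 = d →
      (∀ i, i ≠ 0 → M.edge (c i) ∈ T) → M.IsLeftOf c outer

end PlanarMap

/-! ### Incidence relations between darts, vertices, edges and faces -/

namespace PlanarMap

variable {D : Type*} (M : PlanarMap D)

/-! Existence is greedy. Edges are removed while accessibility survives; each removed edge is
saturated and is crossed from the region of the outer face, which lies on its left. A maximal
removed set is `C` (`exists_cyclicForest`). If the outer region `A` does not yet contain every face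
but the root face, let `B` be the set of missing faces. Were no edge between them removable, a
comparison of accessibility cuts would show that every boundary edge of `B` carries flow with `B` on
its left. The boundary would then contain a counterclockwise circuit, against minimality
(`exists_removable`). Where `B` touches the root face, the orientation of the contour gives this
flow.

For uniqueness, cross only edges that both partitions remove. If some non-root face is not reached,
some edge `d` on the frontier is removed by the first partition and kept by the second. It
disconnects the second forest, and accessibility of the first yields an oriented exit `y` from the
component behind `d`. The edge `y` is removed by the second partition and closes a cycle that runs
backwards along `d`, with the outer face on its right: a contradiction (`sameRegion_union`). Hence
all non-root faces communicate, and an edge kept by one forest only would have its two sides joined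
without crossing a cycle through it (`subset_of_sameRegion_union`).

The Jordan curve theorem used for uniqueness comes from a discrete Hodge decomposition: gradients
are orthogonal to dual gradients, and Euler's formula makes them span. Existence needs only the
orthogonality, through `exists_boundary_exit`. -/

lemma src_rot (d : D) : M.src (M.rot d) = M.src d :=
  Quotient.sound (s := Equiv.Perm.SameCycle.setoid M.rot) ⟨-1, by simp⟩

lemma left_rot_symm (d : D) : M.left (M.rot⁻¹ d) = M.right d := by
  refine Quotient.sound (s := Equiv.Perm.SameCycle.setoid M.faceNext) ⟨-1, ?_⟩
  rw [zpow_neg_one, Equiv.Perm.inv_eq_iff_eq]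
  simp [faceNext, M.opp_opp]

lemma left_rot (d : D) : M.right (M.rot d) = M.left d := by
  rw [← left_rot_symm]; exact congrArg M.left (M.rot.symm_apply_apply d)

lemma tgt_opp (d : D) : M.tgt (M.opp d) = M.src d := by rw [tgt, M.opp_opp]

lemma right_opp (d : D) : M.right (M.opp d) = M.left d := by rw [right, M.opp_opp]

lemma edge_eq_iff {d d' : D} : M.edge d = M.edge d' ↔ d = d' ∨ d = M.opp d' := by
  have hsq : M.opp ^ 2 = 1 := by ext x; simp [pow_two, M.opp_opp]
  constructor
  · intro h
    obtain ⟨i, hi⟩ := (Quotient.exact (s := Equiv.Perm.SameCycle.setoid M.opp) h :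
      M.opp.SameCycle d d')
    obtain ⟨j, rfl | rfl⟩ := Int.even_or_odd' i
    · left
      rw [zpow_mul] at hi
      have h2 : M.opp ^ (2 : ℤ) = 1 := by exact_mod_cast hsq
      simpa [h2] using hi
    · right
      rw [zpow_add, zpow_mul] at hi
      have h2 : M.opp ^ (2 : ℤ) = 1 := by exact_mod_cast hsq
      rw [← hi]
      simp [h2, M.opp_opp]
  · rintro (rfl | rfl)
    · rfl
    · exact Quotient.sound (s := Equiv.Perm.SameCycle.setoid M.opp) ⟨1, by simp [M.opp_opp]⟩

lemma edge_opp (d : D) : M.edge (M.opp d) = M.edge d := M.edge_eq_iff.2 (Or.inr rfl)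

lemma exists_edge (e : M.Edge) : ∃ d, M.edge d = e := Quotient.exists_rep e

lemma exists_src (v : M.Vertex) : ∃ d, M.src d = v := Quotient.exists_rep v

lemma exists_left (f : M.Face) : ∃ d, M.left d = f := Quotient.exists_rep f

/-- A function on darts that is invariant under the two permutations of the map is constant. -/
lemma eq_of_invariant {α : Type*} (f : D → α) (hrot : ∀ d, f (M.rot d) = f d)
    (hopp : ∀ d, f (M.opp d) = f d) (a b : D) : f a = f b := by
  obtain ⟨g, hg, rfl⟩ := M.connected a b
  suffices ∀ g ∈ Subgroup.closure {M.rot, M.opp}, ∀ a, f (g a) = f a from (this g hg a).symm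
  intro g hg
  induction hg using Subgroup.closure_induction with
  | mem x hx =>
    rcases hx with rfl | rfl
    · exact hrot
    · exact hopp
  | one => simp
  | mul x y _ _ hx hy => intro a; simp [hx, hy]
  | inv x _ hx => intro a; rw [← hx]; exact congrArg f (x.apply_symm_apply a)

/-! ### Regions -/

variable {M}

lemma AdjOff.symm {S : Set M.Edge} {f g : M.Face} (h : M.AdjOff S f g) : M.AdjOff S g f := by
  obtain ⟨d, hd, rfl, rfl⟩ := h
  exact ⟨M.opp d, by rwa [edge_opp], rfl, M.right_opp d⟩

lemma SameRegion.symm {S : Set M.Edge} {f g : M.Face} (h : M.SameRegion S f g) :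
    M.SameRegion S g f := by
  induction h with
  | refl => exact .refl
  | tail _ h ih => exact .head h.symm ih

lemma SameRegion.trans {S : Set M.Edge} {f g h : M.Face} (h₁ : M.SameRegion S f g)
    (h₂ : M.SameRegion S g h) : M.SameRegion S f h := Relation.ReflTransGen.trans h₁ h₂

lemma SameRegion.anti {S S' : Set M.Edge} (hS : S' ⊆ S) {f g : M.Face}
    (h : M.SameRegion S f g) : M.SameRegion S' f g :=
  Relation.ReflTransGen.mono (fun _ _ ⟨d, hd, h⟩ => ⟨d, fun h' => hd (hS h'), h⟩) _ _ h

lemma sameRegion_left_right {S : Set M.Edge} {d : D} (hd : M.edge d ∉ S) :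
    M.SameRegion S (M.left d) (M.right d) := .single ⟨d, hd, rfl, rfl⟩

/-- If a vertex carries only two darts of `S`, the faces met when turning from one to the other
lie in the same region. -/
lemma sameRegion_of_corner [Finite D] {S : Set M.Edge} {x y : D} (hxy : x ≠ y)
    (hv : M.src x = M.src y) (hS : ∀ d, M.src d = M.src x → M.edge d ∈ S → d = x ∨ d = y) :
    M.SameRegion S (M.left x) (M.right y) := by
  have hex : ∃ n : ℕ, (M.rot ^ n) x = y := by
    have h : M.rot.SameCycle x y := Quotient.exact (s := Equiv.Perm.SameCycle.setoid M.rot) hv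
    obtain ⟨n, -, h⟩ := h.exists_pow_eq'
    exact ⟨n, h⟩
  classical
  obtain ⟨hN, hmin⟩ : (M.rot ^ Nat.find hex) x = y ∧ ∀ m < Nat.find hex, (M.rot ^ m) x ≠ y :=
    ⟨Nat.find_spec hex, fun m hm => Nat.find_min hex hm⟩
  generalize Nat.find hex = N at hN hmin
  have hsrc : ∀ m : ℕ, M.src ((M.rot ^ m) x) = M.src x := by
    intro m
    induction m with
    | zero => rfl
    | succ m ih => rw [pow_succ', Equiv.Perm.mul_apply, src_rot, ih]
  have key : ∀ m < N, M.SameRegion S (M.left x) (M.left ((M.rot ^ m) x)) := by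
    intro m
    induction m with
    | zero => intro _; exact .refl
    | succ m ih =>
      intro hm
      refine (ih (by omega)).trans ?_
      rw [pow_succ', Equiv.Perm.mul_apply, ← M.left_rot]
      refine (sameRegion_left_right fun he => ?_).symm
      rw [← Equiv.Perm.mul_apply, ← pow_succ'] at he
      rcases hS _ (hsrc _) he with h | h
      -- A return to `x` after `m + 1` turns would bring `y` forward to turn `N - (m + 1)`.
      · refine hmin (N - (m + 1)) (by omega) ?_
        conv_lhs => rw [← h, ← Equiv.Perm.mul_apply, ← pow_add]
        rw [Nat.sub_add_cancel hm.le, hN]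
      · exact hmin _ hm h
  obtain _ | N := N
  · exact absurd hN hxy
  · have := key N (by omega)
    rwa [← M.left_rot ((M.rot ^ N) x), ← Equiv.Perm.mul_apply, ← pow_succ', hN] at this

/-! ### The two sides of a simple cycle -/

section Cycle

variable {n : ℕ} {c : Fin (n + 1) → D}

lemma IsSimpleCycle.opp_ne (hc : M.IsSimpleCycle c) (i j : Fin (n + 1)) :
    c i ≠ M.opp (c j) := by
  intro h
  obtain rfl := hc.edge_injective (M.edge_eq_iff.2 (Or.inr h) : M.edge (c i) = M.edge (c j))
  exact M.opp_ne _ h.symm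

lemma IsSimpleCycle.injective (hc : M.IsSimpleCycle c) : Function.Injective c := fun i j h =>
  hc.src_injective (by simp [h])

lemma IsSimpleCycle.dart_at (hc : M.IsSimpleCycle c) (i : Fin (n + 1)) {d : D}
    (hd : M.src d = M.src (c (i + 1))) (he : M.edge d ∈ Set.range fun j => M.edge (c j)) :
    d = c (i + 1) ∨ d = M.opp (c i) := by
  obtain ⟨j, hj⟩ := he
  rcases M.edge_eq_iff.1 hj.symm with rfl | rfl
  · left; rw [hc.src_injective hd]
  · right
    have : M.src (c (j + 1)) = M.src (c (i + 1)) := by rw [← hc.chain, ← hd]; rfl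
    rw [add_right_cancel (hc.src_injective this)]

lemma IsSimpleCycle.left_succ [Finite D] (hc : M.IsSimpleCycle c) (i : Fin (n + 1)) :
    M.SameRegion (Set.range fun j => M.edge (c j)) (M.left (c (i + 1))) (M.left (c i)) := by
  rw [← M.right_opp (c i)]
  exact sameRegion_of_corner (hc.opp_ne _ _) (hc.chain i).symm fun d h h' => hc.dart_at i h h'

lemma IsSimpleCycle.right_succ [Finite D] (hc : M.IsSimpleCycle c) (i : Fin (n + 1)) :
    M.SameRegion (Set.range fun j => M.edge (c j)) (M.right (c i)) (M.right (c (i + 1))) :=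
  sameRegion_of_corner (x := M.opp (c i)) (hc.opp_ne _ _).symm (hc.chain i)
    fun _ h h' => (hc.dart_at i (h.trans (hc.chain i)) h').symm

lemma IsSimpleCycle.left_left [Finite D] (hc : M.IsSimpleCycle c) (i : Fin (n + 1)) :
    M.SameRegion (Set.range fun j => M.edge (c j)) (M.left (c i)) (M.left (c 0)) := by
  induction i using Fin.induction with
  | zero => exact .refl
  | succ i ih => rw [← Fin.coeSucc_eq_succ]; exact (hc.left_succ _).trans ih

lemma IsSimpleCycle.right_right [Finite D] (hc : M.IsSimpleCycle c) (i : Fin (n + 1)) :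
    M.SameRegion (Set.range fun j => M.edge (c j)) (M.right (c i)) (M.right (c 0)) := by
  induction i using Fin.induction with
  | zero => exact .refl
  | succ i ih => rw [← Fin.coeSucc_eq_succ]; exact (hc.right_succ _).symm.trans ih

end Cycle

/-! ### The Jordan curve theorem -/

section Jordan

variable (M)

/-- The gradient of a function on vertices. -/
def grad (p : M.Vertex → ℝ) (d : D) : ℝ := p (M.src d) - p (M.tgt d)

/-- The gradient of a function on faces, along dual edges. -/
def cograd (φ : M.Face → ℝ) (d : D) : ℝ := φ (M.left d) - φ (M.right d)

variable {M}

lemma grad_opp (p : M.Vertex → ℝ) (d : D) : M.grad p (M.opp d) = -M.grad p d := by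
  simp [grad, tgt, M.opp_opp]

lemma cograd_opp (φ : M.Face → ℝ) (d : D) : M.cograd φ (M.opp d) = -M.cograd φ d := by
  simp [cograd, right, M.opp_opp]

variable [Fintype D]

lemma sum_grad_mul (p : M.Vertex → ℝ) (g : D → ℝ) (hg : ∀ d, g (M.opp d) = -g d) :
    ∑ d, M.grad p d * g d = 2 * ∑ d, p (M.src d) * g d := by
  have h : ∑ d, p (M.tgt d) * g d = -∑ d, p (M.src d) * g d := by
    rw [← Equiv.sum_comp M.opp, ← Finset.sum_neg_distrib]
    exact Finset.sum_congr rfl fun d _ => by rw [tgt_opp, hg]; ring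
  simp only [grad, sub_mul, Finset.sum_sub_distrib, h]
  ring

/-- After summation by parts, the differences of face values around each vertex telescope under
`rot`. Euler's formula plays no role. -/
lemma sum_grad_mul_cograd (p : M.Vertex → ℝ) (φ : M.Face → ℝ) :
    ∑ d, M.grad p d * M.cograd φ d = 0 := by
  rw [sum_grad_mul p _ (cograd_opp φ)]
  simp only [cograd, mul_sub, Finset.sum_sub_distrib]
  have : ∑ d, p (M.src d) * φ (M.right d) = ∑ d, p (M.src d) * φ (M.left d) := by
    rw [← Equiv.sum_comp M.rot]
    simp only [src_rot, left_rot]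
  rw [this]; simp

/-- The gradient is minus a dual gradient, hence orthogonal to itself. -/
lemma grad_eq_zero_of_add {p : M.Vertex → ℝ} {φ : M.Face → ℝ}
    (h : ∀ d, M.grad p d + M.cograd φ d = 0) (d : D) : M.grad p d = 0 := by
  have h0 : ∑ d, M.grad p d * M.grad p d = 0 := by
    rw [← neg_eq_zero, ← sum_grad_mul_cograd p φ, ← Finset.sum_neg_distrib]
    refine Finset.sum_congr rfl fun d _ => ?_
    rw [eq_neg_of_add_eq_zero_right (h d)]; ring
  rw [Finset.sum_eq_zero_iff_of_nonneg fun d _ => mul_self_nonneg _] at h0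
  simpa using h0 d (Finset.mem_univ d)

/-- Every antisymmetric function on the darts of a map on the sphere is the sum of a gradient and
of a dual gradient. -/
lemma exists_grad_add_cograd (g : D → ℝ) (hg : ∀ d, g (M.opp d) = -g d) :
    ∃ p φ, ∀ d, M.grad p d + M.cograd φ d = g d := by
  classical
  rcases isEmpty_or_nonempty D with hD | ⟨⟨d₀⟩⟩
  · exact ⟨0, 0, fun d => hD.elim d⟩
  have : Finite M.Vertex := Quotient.finite _
  have : Finite M.Face := Quotient.finite _
  have : Finite M.Edge := Quotient.finite _
  have := Fintype.ofFinite M.Vertex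
  have := Fintype.ofFinite M.Face
  have := Fintype.ofFinite M.Edge
  -- One dart per edge identifies antisymmetric functions on darts with functions on edges.
  choose r hr using M.exists_edge
  have hext : ∀ {g g' : D → ℝ}, (∀ d, g (M.opp d) = -g d) → (∀ d, g' (M.opp d) = -g' d) →
      (∀ e, g (r e) = g' (r e)) → ∀ d, g d = g' d := by
    intro g g' hg hg' h d
    rcases M.edge_eq_iff.1 (hr (M.edge d)).symm with h' | h'
    · rw [h']; exact h _
    · rw [h', hg, hg', h]
  let L : ((M.Vertex → ℝ) × (M.Face → ℝ)) →ₗ[ℝ] (M.Edge → ℝ) :=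
    { toFun := fun q e => M.grad q.1 (r e) + M.cograd q.2 (r e)
      map_add' := fun q q' => by ext e; simp [grad, cograd]; ring
      map_smul' := fun a q => by ext e; simp [grad, cograd]; ring }
  -- Both potentials of a kernel element are constant, so two base values determine it. The kernel
  -- has dimension at most 2, and Euler's formula then forces `L` to be surjective.
  let K : LinearMap.ker L →ₗ[ℝ] ℝ × ℝ :=
    { toFun := fun q => (q.1.1 (M.src d₀), q.1.2 (M.left d₀))
      map_add' := fun q q' => rfl
      map_smul' := fun a q => rfl }
  have hK : Function.Injective K := by
    rw [← LinearMap.ker_eq_bot, LinearMap.ker_eq_bot']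
    rintro ⟨⟨p, φ⟩, hq⟩ h0
    have h1 : p (M.src d₀) = 0 := congrArg Prod.fst h0
    have h2 : φ (M.left d₀) = 0 := congrArg Prod.snd h0
    have hs : ∀ d, M.grad p d + M.cograd φ d = 0 :=
      hext (g' := fun _ => 0) (fun d => by rw [grad_opp, cograd_opp]; ring) (by simp)
        fun e => congrFun (LinearMap.mem_ker.1 hq) e
    have hgrad := grad_eq_zero_of_add hs
    have hcograd : ∀ d, M.cograd φ d = 0 := fun d => by simpa [hgrad d] using hs d
    have hp : ∀ v, p v = 0 := fun v => by
      obtain ⟨d, rfl⟩ := M.exists_src v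
      rw [← h1]
      exact M.eq_of_invariant (fun d => p (M.src d)) (fun d => by rw [src_rot])
        (fun d => (sub_eq_zero.1 (hgrad d)).symm) _ _
    have hφ : ∀ f, φ f = 0 := fun f => by
      obtain ⟨d, rfl⟩ := M.exists_left f
      rw [← h2]
      refine M.eq_of_invariant (fun d => φ (M.left d)) (fun d => ?_)
        (fun d => (sub_eq_zero.1 (hcograd d)).symm) _ _
      rw [← M.left_rot d]
      exact sub_eq_zero.1 (hcograd _)
    ext x
    · exact hp x
    · exact hφ x
  have hker : Module.finrank ℝ (LinearMap.ker L) ≤ 2 := by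
    simpa using LinearMap.finrank_le_finrank_of_injective hK
  have heuler : Fintype.card M.Vertex + Fintype.card M.Face = Fintype.card M.Edge + 2 := by
    have h : Nat.card M.Vertex + Nat.card M.Face = Nat.card M.Edge + 2 := M.euler
    rwa [Nat.card_eq_fintype_card, Nat.card_eq_fintype_card, Nat.card_eq_fintype_card] at h
  have hrank := L.finrank_range_add_finrank_ker
  rw [Module.finrank_prod, Module.finrank_fintype_fun_eq_card,
    Module.finrank_fintype_fun_eq_card, heuler] at hrank
  have hsurj : LinearMap.range L = ⊤ := by
    refine Submodule.eq_top_of_finrank_eq (le_antisymm (Submodule.finrank_le _) ?_)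
    rw [Module.finrank_fintype_fun_eq_card]
    omega
  obtain ⟨⟨p, φ⟩, h⟩ := LinearMap.range_eq_top.1 hsurj fun e => g (r e)
  exact ⟨p, φ, hext (fun d => by rw [grad_opp, cograd_opp]; ring) hg fun e => congrFun h e⟩

end Jordan

/-- No face lies on both sides of a simple cycle. -/
theorem IsSimpleCycle.not_left_and_right [Finite D] {n : ℕ} {c : Fin (n + 1) → D}
    (hc : M.IsSimpleCycle c) {f : M.Face} (hl : M.IsLeftOf c f) (hr : M.IsRightOf c f) :
    False := by
  classical
  have := Fintype.ofFinite D
  -- The unit flow around `c`.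
  let g : D → ℝ := fun d => ∑ i, ((if d = c i then 1 else 0) - (if d = M.opp (c i) then 1 else 0))
  have hg : ∀ d, g (M.opp d) = -g d := fun d => by
    simp only [g, ← Finset.sum_neg_distrib, neg_sub, M.opp.injective.eq_iff]
    refine Finset.sum_congr rfl fun i _ => ?_
    have : M.opp d = c i ↔ d = M.opp (c i) :=
      ⟨fun h => by rw [← h, M.opp_opp], fun h => by rw [h, M.opp_opp]⟩
    simp only [this]
  obtain ⟨p, φ, h⟩ := exists_grad_add_cograd g hg
  -- The flow has no divergence, so it is orthogonal to gradients and must be a pure dual gradient.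
  have hpg : ∑ d, M.grad p d * g d = 0 := by
    rw [sum_grad_mul p g hg]
    simp only [g, Finset.mul_sum]
    rw [Finset.sum_comm]
    have hshift : ∑ i, p (M.tgt (c i)) = ∑ i, p (M.src (c i)) := by
      simp only [hc.chain]
      exact Equiv.sum_comp (Equiv.addRight (1 : Fin (n + 1))) fun i => p (M.src (c i))
    simp only [tgt] at hshift
    simp [mul_sub, ← Finset.mul_sum, hshift]
  have hgrad : ∀ d, M.grad p d = 0 := by
    have h0 : ∑ d, M.grad p d * M.grad p d = 0 := by
      simpa only [← h, mul_add, Finset.sum_add_distrib, sum_grad_mul_cograd, add_zero] using hpg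
    rw [Finset.sum_eq_zero_iff_of_nonneg fun d _ => mul_self_nonneg _] at h0
    exact fun d => by simpa using h0 d (Finset.mem_univ d)
  have hφ : ∀ d, φ (M.left d) - φ (M.right d) = g d := fun d => by
    rw [← h, hgrad, zero_add]; rfl
  have hconst : ∀ {a b}, M.SameRegion (Set.range fun j => M.edge (c j)) a b → φ a = φ b := by
    intro a b hab
    induction hab with
    | refl => rfl
    | tail _ hd ih =>
      obtain ⟨d, hd, rfl, rfl⟩ := hd
      rw [ih, ← sub_eq_zero, hφ]
      refine Finset.sum_eq_zero fun i _ => ?_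
      have h1 : d ≠ c i := fun h => hd ⟨i, by simp [h]⟩
      have h2 : d ≠ M.opp (c i) := fun h => hd ⟨i, by simp [h, edge_opp]⟩
      simp [h1, h2]
  have hjump : g (c 0) = 1 := by
    simp only [g, hc.opp_ne, hc.injective.eq_iff]
    simp
  obtain ⟨i, hi⟩ := hl
  obtain ⟨j, hj⟩ := hr
  have h1 := hconst ((hc.left_left i).symm.trans hi)
  have h2 := hconst ((hc.right_right j).symm.trans hj)
  have h3 := hφ (c 0)
  rw [hjump] at h3
  linarith

end PlanarMap

namespace PlanarMap

variable {D : Type*} {M : PlanarMap D}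

/-! ### Extracting simple cycles -/

variable (M) in
/-- There is a dart in `P` from `u` to `v`. -/
def DartStep (P : Set D) (u v : M.Vertex) : Prop := ∃ x ∈ P, M.src x = u ∧ M.tgt x = v

/-- A walk with darts in `P` from the end to the origin of `d` yields a simple cycle through `d`. -/
lemma exists_simpleCycle {P : Set D} {d : D}
    (h : Relation.ReflTransGen (M.DartStep P) (M.tgt d) (M.src d)) (hd : M.opp d ∉ P) :
    ∃ (n : ℕ) (c : Fin (n + 1) → D), M.IsSimpleCycle c ∧ c 0 = d ∧ ∀ i, i ≠ 0 → c i ∈ P := by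
  classical
  have hwalk : ∃ (m : ℕ) (w : ℕ → D), w 0 = d ∧ M.tgt (w m) = M.src d ∧
      ∀ i < m, w (i + 1) ∈ P ∧ M.tgt (w i) = M.src (w (i + 1)) := by
    suffices ∀ v, Relation.ReflTransGen (M.DartStep P) (M.tgt d) v →
        ∃ (m : ℕ) (w : ℕ → D), w 0 = d ∧ M.tgt (w m) = v ∧
          ∀ i < m, w (i + 1) ∈ P ∧ M.tgt (w i) = M.src (w (i + 1)) from this _ h
    intro v hv
    induction hv with
    | refl => exact ⟨0, fun _ => d, rfl, rfl, by simp⟩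
    | tail _ hx ih =>
      obtain ⟨m, w, h0, hm, hw⟩ := ih
      obtain ⟨x, hxP, hx, rfl⟩ := hx
      refine ⟨m + 1, fun i => if i ≤ m then w i else x, by simp [h0], by simp, fun i hi => ?_⟩
      rcases Nat.lt_succ_iff_lt_or_eq.1 hi with hi | rfl
      · have : i + 1 ≤ m := hi
        simpa [hi.le, this] using hw i hi
      · simp [hxP, hm, hx]
  -- A shortest walk is taken; a repeated source would allow a shortcut.
  obtain ⟨w, h0, hm, hw⟩ := Nat.find_spec hwalk
  have hmin := fun m hm => Nat.find_min hwalk (m := m) hm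
  generalize Nat.find hwalk = m at hm hw hmin
  have hne : ∀ i j, i < j → j ≤ m → M.src (w i) ≠ M.src (w j) := by
    intro i j hij hjm he
    obtain _ | i := i
    · refine hmin (j - 1) (by omega) ⟨w, h0, ?_, fun i hi => hw i (by omega)⟩
      rw [(hw (j - 1) (by omega)).2, Nat.sub_add_cancel hij, ← he, h0]
    · refine hmin (m - (j - (i + 1))) (by omega)
        ⟨fun t => if t ≤ i then w t else w (t + (j - (i + 1))), by simpa using h0, ?_, ?_⟩
      · have h1 : ¬ m - (j - (i + 1)) ≤ i := by omega
        have h2 : m - (j - (i + 1)) + (j - (i + 1)) = m := by omega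
        simpa only [h1, if_false, h2] using hm
      · intro t ht
        rcases lt_trichotomy t i with h | rfl | h
        · have h1 : t + 1 ≤ i := h
          simpa only [h.le, h1, if_true] using hw t (by omega)
        · have h1 : ¬ t + 1 ≤ t := by omega
          have h2 : t + 1 + (j - (t + 1)) = j := by omega
          simp only [le_refl, h1, if_true, if_false, h2]
          refine ⟨?_, by rw [← he]; exact (hw t (by omega)).2⟩
          have := (hw (j - 1) (by omega)).1
          rwa [Nat.sub_add_cancel (by omega)] at this
        · have h1 : ¬ t ≤ i := by omega
          have h2 : ¬ t + 1 ≤ i := by omega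
          have h3 : t + 1 + (j - (i + 1)) = t + (j - (i + 1)) + 1 := by omega
          simp only [h1, h2, if_false, h3]
          exact hw _ (by omega)
  let c : Fin (m + 1) → D := fun i => w i
  have hchain : ∀ i, M.tgt (c i) = M.src (c (i + 1)) := by
    intro i
    rcases eq_or_ne i (Fin.last m) with rfl | hi
    · simpa [c, h0] using hm
    · have hi' : (i : ℕ) < m := Fin.val_lt_last hi
      simp only [c, Fin.val_add_one_of_lt (Fin.lt_last_iff_ne_last.2 hi)]
      exact (hw i hi').2
  have hsrc : Function.Injective fun i => M.src (c i) := by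
    intro i j hij
    rcases lt_trichotomy i j with h | h | h
    · exact absurd hij (hne _ _ h (by omega))
    · exact h
    · exact absurd hij.symm (hne _ _ h (by omega))
  have hP : ∀ i, i ≠ 0 → c i ∈ P := by
    intro i hi
    have h1 : (i : ℕ) ≠ 0 := fun h => hi (Fin.ext h)
    have := (hw (i - 1) (by omega)).1
    rwa [Nat.sub_add_cancel (by omega)] at this
  refine ⟨m, c, ⟨hchain, hsrc, fun i j hij => ?_⟩, h0, hP⟩
  rcases M.edge_eq_iff.1 hij with h | h
  · exact hsrc (congrArg M.src h)
  -- Opposite darts can only be consecutive in both cyclic orders. For distinct indices, either one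
  -- of them is `0`, which puts `M.opp d` in `P`, or both successor relations hold in `ℕ`, which is
  -- absurd.
  · have h1 : i = j + 1 := hsrc (by
      simp only [← hchain, h]; rfl)
    have h2 : j = i + 1 := hsrc (by
      simp only [← hchain, h, tgt_opp])
    by_contra hne
    by_cases hi : i = 0
    · have hj : j ≠ 0 := fun hj => hne (hi.trans hj.symm)
      refine hd ?_
      have : M.opp (c i) = c j := by rw [h, M.opp_opp]
      rw [hi] at this
      have hc0 : c 0 = d := h0
      rw [← hc0, this]
      exact hP j hj
    · by_cases hj : j = 0
      · refine hd ?_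
        have hc0 : c 0 = d := h0
        rw [← hc0, ← hj, ← h]
        exact hP i hi
      · have hlast : ∀ a b : Fin (m + 1), a ≠ 0 → a = b + 1 → (a : ℕ) = b + 1 := by
          intro a b ha hab
          have : b ≠ Fin.last m := fun hb => ha (by rw [hab, hb, Fin.last_add_one])
          rw [hab, Fin.val_add_one_of_lt (Fin.lt_last_iff_ne_last.2 this)]
        have := hlast i j hi h1
        have := hlast j i hj h2
        omega

/-- The boundary of a set of faces enters a set of vertices as often as it leaves it. -/
lemma exists_boundary_exit [Finite D] (U : Set M.Vertex) (B : Set M.Face) {x : D}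
    (hl : M.left x ∈ B) (hr : M.right x ∉ B) (hs : M.src x ∉ U) (ht : M.tgt x ∈ U) :
    ∃ y, M.left y ∈ B ∧ M.right y ∉ B ∧ M.src y ∈ U ∧ M.tgt y ∉ U := by
  classical
  have := Fintype.ofFinite D
  by_contra! hno
  have h := sum_grad_mul_cograd (M := M) (fun v => if v ∈ U then 1 else 0)
    (fun f => if f ∈ B then 1 else 0)
  -- Only an exit along the boundary could contribute a positive term, while `x` contributes a
  -- negative one.
  refine absurd h (ne_of_lt (Finset.sum_neg' (fun d _ => ?_) ⟨x, Finset.mem_univ x, ?_⟩))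
  · have h1 := hno d
    have h2 := hno (M.opp d)
    rw [right_opp, tgt_opp] at h2
    change M.right d ∈ B → M.left d ∉ B → M.tgt d ∈ U → M.src d ∈ U at h2
    simp only [grad, cograd]
    by_cases a1 : M.left d ∈ B <;> by_cases a2 : M.right d ∈ B <;>
      by_cases a3 : M.src d ∈ U <;> by_cases a4 : M.tgt d ∈ U <;> simp_all
  · simp [grad, cograd, hl, hr, hs, ht]

/-- A path of faces leaving a set of faces crosses its boundary. -/
lemma SameRegion.exists_exit {S : Set M.Edge} {f g : M.Face} (h : M.SameRegion S f g)
    {A : Set M.Face} (hf : f ∈ A) (hg : g ∉ A) :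
    ∃ d, M.edge d ∉ S ∧ M.left d ∈ A ∧ M.right d ∉ A := by
  induction h with
  | refl => exact absurd hf hg
  | @tail b e _ hd ih =>
    by_cases hb : b ∈ A
    · obtain ⟨d, hd, rfl, rfl⟩ := hd
      exact ⟨d, hd, hb, hg⟩
    · exact ih hb

/-- The faces other than `root` lie in one region of the complement of the contour of `root`. -/
lemma IsSimpleCycle.sameRegion_of_ne [Finite D] {n : ℕ} {c : Fin (n + 1) → D}
    (hc : M.IsSimpleCycle c) {root : M.Face} (hroot : ∀ d, M.left d = root ↔ d ∈ Set.range c)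
    {f g : M.Face} (hf : f ≠ root) (hg : g ≠ root) :
    M.SameRegion (Set.range fun j => M.edge (c j)) f g := by
  let Q : M.Face → Prop := fun f =>
    f = root ∨ M.SameRegion (Set.range fun j => M.edge (c j)) (M.right (c 0)) f
  have hQ : ∀ d, Q (M.left d) → Q (M.right d) := by
    intro d h
    by_cases hd : M.edge d ∈ Set.range fun j => M.edge (c j)
    · obtain ⟨i, hi⟩ := hd
      rcases M.edge_eq_iff.1 hi.symm with rfl | rfl
      · exact Or.inr (hc.right_right i).symm
      · exact Or.inl (by rw [right_opp]; exact (hroot _).2 ⟨i, rfl⟩)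
    · rcases h with h | h
      · obtain ⟨i, rfl⟩ := (hroot d).1 h
        exact absurd ⟨i, rfl⟩ hd
      · exact Or.inr (h.trans (sameRegion_left_right hd))
  have hQ' : ∀ d, Q (M.right d) = Q (M.left d) := fun d =>
    propext ⟨fun h => by simpa only [right_opp] using hQ (M.opp d) h, hQ d⟩
  have hall : ∀ f, Q f := fun f => by
    obtain ⟨d, rfl⟩ := M.exists_left f
    have := M.eq_of_invariant (fun d => Q (M.left d))
      (fun d => by rw [← hQ', left_rot]) hQ' d (c 0)
    rw [this]
    exact Or.inl ((hroot _).2 ⟨0, rfl⟩)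
  exact ((hall f).resolve_left hf).symm.trans ((hall g).resolve_left hg)

end PlanarMap

/-! ### Existence: removing edges while accessibility survives -/

namespace PlanarMap

variable {D : Type*} {M : PlanarMap D} {k : ℕ}

namespace FracOrientation

variable (O : M.FracOrientation k)

/-- There is an oriented path with edges in `S` from `v` to a vertex incident to `root`. -/
def Reaches (root : M.Face) (S : Set M.Edge) (v : M.Vertex) : Prop :=
  ∃ d, M.left d = root ∧ Relation.ReflTransGen (O.Step S) v (M.src d)

variable {O} {root outer : M.Face}

lemma Reaches.exists_exit {S : Set M.Edge} {v : M.Vertex} (h : O.Reaches root S v)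
    {U : Set M.Vertex} (hv : v ∈ U) (hU : ∀ d, M.left d = root → M.src d ∉ U) :
    ∃ x, M.edge x ∈ S ∧ 0 < O.flow x ∧ M.src x ∈ U ∧ M.tgt x ∉ U := by
  obtain ⟨d, hd, h⟩ := h
  induction h using Relation.ReflTransGen.head_induction_on with
  | refl => exact absurd hv (hU d hd)
  | @head a b hx _ ih =>
    by_cases hb : b ∈ U
    · exact ih hb
    · obtain ⟨x, hxS, hx, rfl, rfl⟩ := hx
      exact ⟨x, hxS, hx, hv, hb⟩

/-- If removing the edge of a saturated dart destroys accessibility, this dart is the only exit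
from the set of vertices that become disconnected from the root. -/
lemma bridge_exit {S : Set M.Edge} (hacc : O.AccessibleOn root S) {d : D}
    (hd : O.flow (M.opp d) = 0) (hbridge : ¬ O.AccessibleOn root (S \ {M.edge d})) :
    ¬ O.Reaches root (S \ {M.edge d}) (M.src d) ∧ O.Reaches root (S \ {M.edge d}) (M.tgt d) ∧
      ∀ x, M.edge x ∈ S → 0 < O.flow x → ¬ O.Reaches root (S \ {M.edge d}) (M.src x) →
        O.Reaches root (S \ {M.edge d}) (M.tgt x) → x = d := by
  have hexit : ∀ x, M.edge x ∈ S → 0 < O.flow x → ¬ O.Reaches root (S \ {M.edge d}) (M.src x) →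
      O.Reaches root (S \ {M.edge d}) (M.tgt x) → x = d := by
    intro x hxS hx hs ⟨r, hr, ht⟩
    by_cases he : M.edge x = M.edge d
    · rcases M.edge_eq_iff.1 he with h | rfl
      · exact h
      · omega
    · exact absurd ⟨r, hr, .head ⟨x, ⟨hxS, he⟩, hx, rfl, rfl⟩ ht⟩ hs
  obtain ⟨v, hv⟩ := not_forall.1 hbridge
  obtain ⟨x, hxS, hx, hs, ht⟩ := Reaches.exists_exit (hacc v)
    (U := {v | ¬ O.Reaches root (S \ {M.edge d}) v}) hv
    (fun r hr h => h ⟨r, hr, .refl⟩)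
  obtain rfl := hexit x hxS hx hs (not_not.1 ht)
  exact ⟨hs, not_not.1 ht, hexit⟩

/-- Two edges whose removal destroys accessibility cannot cross each other's cut in opposite
directions. -/
lemma bridge_not_cross {S : Set M.Edge} (hacc : O.AccessibleOn root S) {d d' : D}
    (hd' : O.flow (M.opp d') = 0) (hbridge' : ¬ O.AccessibleOn root (S \ {M.edge d'}))
    (hs : O.Reaches root (S \ {M.edge d}) (M.src d'))
    (ht : ¬ O.Reaches root (S \ {M.edge d}) (M.tgt d')) : False := by
  obtain ⟨hs', -, hexit'⟩ := bridge_exit hacc hd' hbridge'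
  obtain ⟨r, hr, h⟩ := hs
  -- Going back along a path that avoids `d`, the first failure to reach the root without `d'` could
  -- only occur at `d'` itself. But then the rest of the path would connect the end of `d'` to the
  -- root without `d`.
  refine hs' ?_
  generalize M.src d' = v at h
  induction h using Relation.ReflTransGen.head_induction_on with
  | refl => exact ⟨r, hr, .refl⟩
  | @head a b hx hb ih =>
    obtain ⟨x, ⟨hxS, hxd⟩, hx, rfl, rfl⟩ := hx
    by_contra hsx
    obtain rfl := hexit' x hxS hx hsx ih
    exact ht ⟨r, hr, hb⟩

/-- As long as the faces accessible from the outer face by crossing removed edges are not all the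
faces except the root face, one more edge can be removed. -/
lemma exists_removable [Finite D] (hmin : O.Minimal outer)
    (hroot : ∀ d, M.left d = root → 0 < O.flow (M.opp d)) {X : Set M.Edge}
    (hX : ∀ d, M.left d = root → M.edge d ∉ X) (hacc : O.AccessibleOn root Xᶜ) {d₀ : D}
    (hl : M.SameRegion Xᶜ outer (M.left d₀))
    (hr : ¬ M.SameRegion Xᶜ outer (M.right d₀)) (hr' : M.right d₀ ≠ root) :
    ∃ d, M.SameRegion Xᶜ outer (M.left d) ∧ ¬ M.SameRegion Xᶜ outer (M.right d) ∧
      M.right d ≠ root ∧ O.flow d = k ∧ O.AccessibleOn root (Xᶜ \ {M.edge d}) := by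
  by_contra! hno
  let A : Set M.Face := {f | M.SameRegion Xᶜ outer f}
  let B : Set M.Face := {f | f ∉ A ∧ f ≠ root}
  have hnotB : ∀ {f}, f ∈ A → f ∉ B := fun h h' => h'.1 h
  have hBX : ∀ {y}, M.left y ∈ B → M.right y ∉ B → M.edge y ∉ X := by
    intro y h1 h2 hy
    by_cases h3 : M.right y ∈ A
    · exact h1.1 (h3.trans (sameRegion_left_right (not_not.2 hy)).symm)
    · have h4 : M.right y = root := by_contra fun h => h2 ⟨h3, h⟩
      exact hX (M.opp y) h4 (by rwa [edge_opp])
  have hflow : ∀ {d}, O.flow (M.opp d) = 0 → O.flow d = k := fun {d} h => by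
    have := O.flow_add d
    omega
  have hAB : ∀ d, M.left d ∈ A → M.right d ∈ B → 0 < O.flow (M.opp d) := by
    intro d h1 h2
    by_contra hd
    have hd : O.flow (M.opp d) = 0 := by omega
    have hb := hno d h1 h2.1 h2.2 (hflow hd)
    obtain ⟨hs, ht, hexit⟩ := bridge_exit hacc hd hb
    -- With `B` on its left, `M.opp d` enters the set cut off by `d`, so another boundary dart `y`
    -- leaves it. Flow along `y` would contradict that `d` is the only exit; without such flow,
    -- `M.opp y` is itself a bridge crossing the cut the wrong way.
    obtain ⟨y, hy1, hy2, hy3, hy4⟩ := exists_boundary_exit (x := M.opp d)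
      {v | ¬ O.Reaches root (Xᶜ \ {M.edge d}) v} B h2 (by rw [right_opp]; exact hnotB h1)
      (not_not.2 ht) (by rw [tgt_opp]; exact hs)
    by_cases hy : 0 < O.flow y
    · rw [hexit y (hBX hy1 hy2) hy hy3 (not_not.1 hy4)] at hy1
      exact hnotB h1 hy1
    · have hyr : M.right y ≠ root := fun h => hy (by
        simpa only [M.opp_opp] using hroot (M.opp y) h)
      have hyA : M.right y ∈ A := by_contra fun h => hy2 ⟨h, hyr⟩
      have hy0 : O.flow (M.opp (M.opp y)) = 0 := by rw [M.opp_opp]; omega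
      refine bridge_not_cross (d := d) (d' := M.opp y) hacc hy0 (hno _ hyA ?_ ?_ (hflow hy0))
        (not_not.1 hy4) (by rw [tgt_opp]; exact hy3)
      · rw [right_opp]; exact hy1.1
      · rw [right_opp]; exact hy1.2
  let W : Set D := {x | M.left x ∈ B ∧ M.right x ∉ B}
  have hW : ∀ x ∈ W, 0 < O.flow x := by
    rintro x ⟨h1, h2⟩
    by_cases h3 : M.right x ∈ A
    · simpa only [M.opp_opp] using hAB (M.opp x) h3 (by rwa [right_opp])
    · have h4 : M.right x = root := by_contra fun h => h2 ⟨h3, h⟩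
      simpa only [M.opp_opp] using hroot (M.opp x) h4
  have hd₀ : M.opp d₀ ∈ W := ⟨⟨hr, hr'⟩, by rw [right_opp]; exact hnotB hl⟩
  -- The boundary darts enter and leave every vertex set equally, so one can return along them from
  -- the end of `M.opp d₀` to its origin.
  obtain ⟨n, c, hc, hc0, hcW⟩ := exists_simpleCycle (P := W) (d := M.opp d₀)
    (by
      by_contra hns
      obtain ⟨y, hy1, hy2, hy3, hy4⟩ := exists_boundary_exit
        {v | Relation.ReflTransGen (M.DartStep W) (M.tgt (M.opp d₀)) v} B hd₀.1 hd₀.2 hns .refl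
      exact hy4 (hy3.tail ⟨y, ⟨hy1, hy2⟩, rfl, rfl⟩))
    (fun h => by rw [M.opp_opp] at h; exact hnotB hl h.1)
  have hcW : ∀ i, c i ∈ W := fun i => by
    by_cases hi : i = 0
    · rw [hi, hc0]; exact hd₀
    · exact hcW i hi
  refine hmin n c hc (fun i => hW _ (hcW i)) ⟨0, ?_⟩
  rw [hc0, right_opp]
  refine SameRegion.anti ?_ hl.symm
  rintro _ ⟨i, rfl⟩
  exact hBX (hcW i).1 (hcW i).2

end FracOrientation

/-- The boundary edges of the root face are oriented with the root face on their right. -/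
lemma FracOrientation.ContourIsCircuit.flow_opp_pos [Finite D] {O : M.FracOrientation k}
    {root outer : M.Face} (hcircuit : O.ContourIsCircuit root) (hmin : O.Minimal outer)
    (hne : root ≠ outer) (d : D) (hd : M.left d = root) : 0 < O.flow (M.opp d) := by
  obtain ⟨n, c, hc, hroot, hor⟩ := hcircuit
  rcases hor with hor | hor
  -- A circuit with the root face on its left would have the outer face on its right.
  · refine absurd ⟨0, hc.sameRegion_of_ne hroot (fun h => ?_) hne.symm⟩ (hmin n c hc hor)
    obtain ⟨i, hi⟩ := (hroot (M.opp (c 0))).1 h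
    exact hc.opp_ne _ _ hi
  · obtain ⟨i, rfl⟩ := (hroot d).1 hd
    exact hor i

/-- The darts with the root face on their left are connected along the contour. -/
lemma IsSimpleCycle.dartStep_contour {n : ℕ} {c : Fin (n + 1) → D} (hc : M.IsSimpleCycle c)
    {P : Set D} (hP : ∀ i, c i ∈ P) (i : Fin (n + 1)) :
    Relation.ReflTransGen (M.DartStep P) (M.src (c 0)) (M.src (c i)) := by
  induction i using Fin.induction with
  | zero => exact .refl
  | succ i ih =>
    refine ih.tail ⟨_, hP _, rfl, ?_⟩
    rw [hc.chain, Fin.coeSucc_eq_succ]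

lemma DartStep.reflTransGen_symm {T : Set M.Edge} {u v : M.Vertex}
    (h : Relation.ReflTransGen (M.DartStep {d | M.edge d ∈ T}) u v) :
    Relation.ReflTransGen (M.DartStep {d | M.edge d ∈ T}) v u := by
  induction h with
  | refl => exact .refl
  | tail _ h ih =>
    obtain ⟨x, hx, rfl, rfl⟩ := h
    exact .head ⟨M.opp x, by simpa [edge_opp] using hx, rfl, M.tgt_opp x⟩ ih

/-- A set of edges containing the contour of the root face, on which the orientation is accessible,
is connected. -/
lemma FracOrientation.AccessibleOn.connected {O : M.FracOrientation k} {root : M.Face}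
    {T : Set M.Edge} (hacc : O.AccessibleOn root T) {n : ℕ} {c : Fin (n + 1) → D}
    (hc : M.IsSimpleCycle c) (hroot : ∀ d, M.left d = root ↔ d ∈ Set.range c)
    (hcT : ∀ d, M.left d = root → M.edge d ∈ T) (u v : M.Vertex) :
    Relation.ReflTransGen (M.DartStep {d | M.edge d ∈ T}) u v := by
  have key : ∀ u, Relation.ReflTransGen (M.DartStep {d | M.edge d ∈ T}) (M.src (c 0)) u := by
    intro u
    obtain ⟨d, hd, h⟩ := hacc u
    obtain ⟨i, rfl⟩ := (hroot d).1 hd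
    refine (hc.dartStep_contour (fun i => hcT _ ((hroot _).2 ⟨i, rfl⟩)) i).trans
      (DartStep.reflTransGen_symm ?_)
    exact Relation.ReflTransGen.mono (fun a b ⟨x, hx, _, h⟩ => ⟨x, hx, h⟩) _ _ h
  exact (DartStep.reflTransGen_symm (key u)).trans (key v)

/-- Existence of the partition. -/
theorem exists_cyclicForest [Finite D] {root outer : M.Face} (hne : root ≠ outer)
    {O : M.FracOrientation k} (hcircuit : O.ContourIsCircuit root) (hmin : O.Minimal outer)
    (hacc : O.AccessibleOn root Set.univ) :
    ∃ X : Set M.Edge, M.IsSpanningCyclicForest root outer Xᶜ ∧ O.AccessibleOn root Xᶜ ∧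
      ∀ e ∈ X, O.IsClosureEdge outer Xᶜ e := by
  have hflow := hcircuit.flow_opp_pos hmin hne
  obtain ⟨n, c, hc, hroot, -⟩ := hcircuit
  -- The left side of `e` must be reached without crossing `e`: its closing cycles then have the
  -- outer face on their left. This condition persists when `X` grows.
  let Good : Set (Set M.Edge) := {X | O.AccessibleOn root Xᶜ ∧
    (∀ e ∈ X, ∃ d, M.edge d = e ∧ O.flow d = k ∧ M.SameRegion (X \ {e})ᶜ outer (M.left d)) ∧
    ∀ d, M.left d = root → M.edge d ∉ X}
  have : Finite M.Edge := Quotient.finite _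
  obtain ⟨X, ⟨hXacc, hXdir, hXroot⟩, hXmax⟩ := (Set.toFinite Good).exists_maximal
    ⟨∅, by simpa using hacc, by simp, by simp⟩
  have hsame : ∀ f, M.SameRegion Xᶜ root f → f = root := by
    intro f h
    by_contra hf
    obtain ⟨d, hd, hl, hr⟩ := h.exists_exit (A := {root}) rfl hf
    exact hXroot d hl (not_not.1 hd)
  have hrootouter : ¬ M.SameRegion Xᶜ root outer := fun h => hne (hsame _ h).symm
  have htwo : ∀ f, M.SameRegion Xᶜ root f ∨ M.SameRegion Xᶜ outer f := by
    intro f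
    by_contra! hf
    have hfr : f ≠ root := fun h => hf.1 (h ▸ .refl)
    -- Going from `outer` to `f` without crossing the contour, one leaves the outer region through
    -- an edge not on the contour.
    obtain ⟨d₀, hd₀, hl, hr⟩ := (hc.sameRegion_of_ne hroot hne.symm hfr).exists_exit
      (A := {f | M.SameRegion Xᶜ outer f}) .refl hf.2
    have hr' : M.right d₀ ≠ root := fun h => by
      obtain ⟨i, hi⟩ := (hroot (M.opp d₀)).1 h
      exact hd₀ ⟨i, by simp only [hi, edge_opp]⟩
    obtain ⟨d, h1, h2, h3, h4, h5⟩ := O.exists_removable hmin hflow hXroot hXacc hl hr hr'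
    have hdX : M.edge d ∉ X := fun h => h2 (h1.trans (sameRegion_left_right fun h' => h' h))
    refine hdX (hXmax (y := insert (M.edge d) X) ⟨?_, ?_, ?_⟩ (Set.subset_insert _ _)
      (Set.mem_insert _ _))
    · convert h5 using 1
      ext e
      simp [and_comm]
    · rintro e (rfl | he)
      · exact ⟨d, rfl, h4, h1.anti fun e he => by
          simp only [Set.mem_compl_iff, Set.mem_sdiff, Set.mem_insert_iff, Set.mem_singleton_iff,
            not_and, not_not] at he ⊢
          exact fun h => hdX (he (Or.inr h) ▸ h)⟩
      · obtain ⟨x, hx, hxk, hxr⟩ := hXdir e he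
        exact ⟨x, hx, hxk, hxr.anti (Set.compl_subset_compl.2
          (Set.sdiff_subset_sdiff_left (Set.subset_insert _ _)))⟩
    · rintro x hx (h | h)
      · rcases M.edge_eq_iff.1 h with rfl | rfl
        · exact hrootouter (hx ▸ h1.symm)
        · exact h3 hx
      · exact hXroot x hx h
  refine ⟨X, ⟨hXacc.connected hc hroot hXroot, htwo, hrootouter, hsame, n, c, hc, fun d => ?_⟩,
    hXacc, fun e he => ?_⟩
  · rw [← hroot]
    exact ⟨fun h => hsame _ h.2, fun h => ⟨hXroot d h, h ▸ .refl⟩⟩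
  · obtain ⟨d, rfl, hdk, hdr⟩ := hXdir e he
    refine ⟨d, rfl, hdk, fun m c' _ hc0 hcT => ⟨0, ?_⟩⟩
    rw [hc0]
    refine hdr.symm.anti ?_
    rintro _ ⟨i, rfl⟩ ⟨h1, h2⟩
    by_cases hi : i = 0
    · exact h2 (by simp only [Set.mem_singleton_iff, hi, hc0])
    · exact hcT i hi h1

end PlanarMap

/-! ### Uniqueness: comparing two partitions -/

namespace PlanarMap

variable {D : Type*} {M : PlanarMap D} {k : ℕ}

/-- An edge outside a connected spanning submap closes a simple cycle. -/
lemma exists_fundamental_cycle {T : Set M.Edge}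
    (hT : ∀ u v, Relation.ReflTransGen (M.DartStep {d | M.edge d ∈ T}) u v) {d : D}
    (hd : M.edge d ∉ T) :
    ∃ (n : ℕ) (c : Fin (n + 1) → D), M.IsSimpleCycle c ∧ c 0 = d ∧
      ∀ i, i ≠ 0 → M.edge (c i) ∈ T :=
  exists_simpleCycle (hT _ _) (by simpa [edge_opp] using hd)

lemma range_edge_subset {S T : Set M.Edge} (hTS : T ⊆ S) {d : D} (hd : M.edge d ∈ S) {n : ℕ}
    {c : Fin (n + 1) → D} (hc0 : c 0 = d) (hcT : ∀ i, i ≠ 0 → M.edge (c i) ∈ T) :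
    (Set.range fun j => M.edge (c j)) ⊆ S := by
  rintro _ ⟨i, rfl⟩
  by_cases hi : i = 0
  · simpa only [hi, hc0] using hd
  · exact hTS (hcT i hi)

/-- The two sides of a dart on a simple cycle are in distinct regions. -/
lemma IsSimpleCycle.not_sameRegion [Finite D] {n : ℕ} {c : Fin (n + 1) → D}
    (hc : M.IsSimpleCycle c) {S : Set M.Edge} (hS : (Set.range fun j => M.edge (c j)) ⊆ S)
    (i : Fin (n + 1)) : ¬ M.SameRegion S (M.left (c i)) (M.right (c i)) := fun h =>
  hc.not_left_and_right ⟨i, h.anti hS⟩ ⟨i, .refl⟩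

/-- A closure edge met from the side of the outer face is saturated in the direction that has the
outer face on its left. -/
lemma FracOrientation.IsClosureEdge.flow_eq [Finite D] {O : M.FracOrientation k}
    {outer : M.Face} {T S : Set M.Edge}
    (hT : ∀ u v, Relation.ReflTransGen (M.DartStep {d | M.edge d ∈ T}) u v) (hTS : T ⊆ S) {d : D}
    (hdT : M.edge d ∉ T) (hdS : M.edge d ∈ S) (hl : M.SameRegion S outer (M.left d))
    (h : O.IsClosureEdge outer T (M.edge d)) : O.flow d = k := by
  obtain ⟨x, hx, hxk, hxc⟩ := h
  rcases M.edge_eq_iff.1 hx with rfl | rfl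
  · exact hxk
  -- If it were saturated along `M.opp d`, its closing cycle would have the outer face on both
  -- sides.
  · obtain ⟨n, c, hc, hc0, hcT⟩ := exists_fundamental_cycle hT (d := M.opp d)
      (by rwa [edge_opp])
    refine (hc.not_left_and_right (hxc n c hc hc0 hcT) ⟨0, ?_⟩).elim
    rw [hc0, right_opp]
    exact hl.symm.anti (range_edge_subset hTS (by rwa [edge_opp]) hc0 hcT)

/-- A simple cycle leaving a set of vertices comes back to it. -/
lemma IsSimpleCycle.exists_enter {n : ℕ} {c : Fin (n + 1) → D} (hc : M.IsSimpleCycle c)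
    {U : Set M.Vertex} (hs : M.src (c 0) ∈ U) (ht : M.tgt (c 0) ∉ U) :
    ∃ i, i ≠ 0 ∧ M.src (c i) ∉ U ∧ M.tgt (c i) ∈ U := by
  by_contra! hno
  have key : ∀ i, M.tgt (c i) ∉ U := by
    intro i
    induction i using Fin.induction with
    | zero => exact ht
    | succ i ih =>
      refine hno _ (Fin.succ_ne_zero i) ?_
      rwa [hc.chain, Fin.coeSucc_eq_succ] at ih
  refine key (Fin.last n) ?_
  rwa [hc.chain, Fin.last_add_one]

/-- A spanning cyclic forest contains the contour of the root face. -/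
lemma IsSpanningCyclicForest.contour_mem {root outer : M.Face} {T : Set M.Edge}
    (hT : M.IsSpanningCyclicForest root outer T) {n : ℕ} {c : Fin (n + 1) → D}
    (hc : M.IsSimpleCycle c) (hroot : ∀ d, M.left d = root ↔ d ∈ Set.range c) (d : D)
    (hd : M.left d = root) : M.edge d ∈ T := by
  by_contra hdT
  have h := hT.same_root (M.right d) (hd ▸ sameRegion_left_right hdT)
  obtain ⟨i, rfl⟩ := (hroot d).1 hd
  obtain ⟨j, hj⟩ := (hroot _).1 h
  exact hc.opp_ne _ _ hj

section Unique

variable [Finite D] {root outer : M.Face} {O : M.FracOrientation k} {T₁ T₂ : Set M.Edge}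

/-- If both submaps define partitions, the common closure edges connect all the faces other than
the root face. -/
lemma sameRegion_union {n : ℕ} {c : Fin (n + 1) → D} (hc : M.IsSimpleCycle c)
    (hroot : ∀ d, M.left d = root ↔ d ∈ Set.range c)
    (h₁ : M.IsSpanningCyclicForest root outer T₁) (hacc₁ : O.AccessibleOn root T₁)
    (hcl₁ : ∀ e ∉ T₁, O.IsClosureEdge outer T₁ e)
    (h₂ : M.IsSpanningCyclicForest root outer T₂) (hacc₂ : O.AccessibleOn root T₂)
    (hcl₂ : ∀ e ∉ T₂, O.IsClosureEdge outer T₂ e) (f : M.Face) (hf : f ≠ root) :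
    M.SameRegion (T₁ ∪ T₂) outer f := by
  by_contra hfA
  have hreg := (h₁.two_faces f).resolve_left fun h => hf (h₁.same_root f h)
  obtain ⟨d, hd₁, hl, hr⟩ := hreg.exists_exit (A := {f | M.SameRegion (T₁ ∪ T₂) outer f}) .refl hfA
  have hd₂ : M.edge d ∈ T₂ := by
    by_contra hd₂
    exact hr (hl.trans (sameRegion_left_right fun h => h.elim hd₁ hd₂))
  have hne : ∀ x, M.edge x = M.edge d → M.left x ≠ root := fun x hx h =>
    hd₁ (hx ▸ h₁.contour_mem hc hroot x h)
  have hdk : O.flow d = k := (hcl₁ _ hd₁).flow_eq h₁.connected Set.subset_union_left hd₁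
    (Or.inr hd₂) hl
  have hdk' : O.flow (M.opp d) = 0 := by
    have := O.flow_add d
    omega
  let U : Set M.Vertex :=
    {v | Relation.ReflTransGen (M.DartStep {x | M.edge x ∈ T₂ \ {M.edge d}}) (M.src d) v}
  have hU : ∀ x, M.edge x ∈ T₂ → M.edge x ≠ M.edge d → (M.src x ∈ U ↔ M.tgt x ∈ U) := by
    intro x hx hxd
    exact ⟨fun h => h.tail ⟨x, ⟨hx, hxd⟩, rfl, rfl⟩,
      fun h => h.tail ⟨M.opp x, by simpa [edge_opp] using And.intro hx hxd, rfl, M.tgt_opp x⟩⟩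
  have hsU : M.src d ∈ U := .refl
  -- Otherwise a cycle of `T₂` through `d` would separate its two sides, yet both lie in the outer
  -- region of `T₂`.
  have htU : M.tgt d ∉ U := by
    intro htU
    obtain ⟨m, c', hc', hc0, hcT⟩ := exists_simpleCycle (DartStep.reflTransGen_symm htU)
      (by simp [edge_opp])
    have hlr := hc'.not_sameRegion (S := T₂)
      (range_edge_subset Set.sdiff_subset hd₂ hc0 hcT) 0
    rw [hc0] at hlr
    have hout : ∀ x, M.edge x = M.edge d → M.SameRegion T₂ outer (M.left x) := fun x hx =>
      (h₂.two_faces _).resolve_left fun h => hne x hx (h₂.same_root _ h)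
    exact hlr ((hout d rfl).symm.trans (hout (M.opp d) (M.edge_opp d)))
  -- Otherwise oriented paths of `T₂` from the end of `d` to the contour would have to enter `U`
  -- backwards along the saturated `d`.
  have hc0U : M.src (c 0) ∉ U := by
    intro hc0U
    obtain ⟨x, hx, hx0, hxs, hxt⟩ := FracOrientation.Reaches.exists_exit (hacc₂ (M.tgt d))
      (U := Uᶜ) htU (by
      intro r hr hrU
      obtain ⟨i, rfl⟩ := (hroot r).1 hr
      refine hrU (hc0U.trans (hc.dartStep_contour (fun i => ?_) i))
      have hi : M.left (c i) = root := (hroot _).2 ⟨i, rfl⟩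
      exact ⟨h₂.contour_mem hc hroot _ hi, fun h => hne _ h hi⟩)
    have hxd : M.edge x = M.edge d := by
      by_contra hxd
      exact hxs ((hU x hx hxd).2 (not_not.1 hxt))
    rcases M.edge_eq_iff.1 hxd with rfl | rfl
    · exact hxs hsU
    · omega
  -- Accessibility in `T₁`, which lacks `d`, gives another way out of `U`.
  obtain ⟨y, hy₁, hy0, hys, hyt⟩ := FracOrientation.Reaches.exists_exit (hacc₁ (M.src d)) hsU (by
    intro r hr hrU
    obtain ⟨i, rfl⟩ := (hroot r).1 hr
    refine hc0U (hrU.trans (DartStep.reflTransGen_symm (hc.dartStep_contour (fun i => ?_) i)))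
    have hi : M.left (c i) = root := (hroot _).2 ⟨i, rfl⟩
    exact ⟨h₂.contour_mem hc hroot _ hi, fun h => hne _ h hi⟩)
  have hy₂ : M.edge y ∉ T₂ := fun hy₂ =>
    hyt ((hU y hy₂ fun h => hd₁ (h ▸ hy₁)).1 hys)
  obtain ⟨z, hz, hzk, hzc⟩ := hcl₂ _ hy₂
  obtain rfl : z = y := (M.edge_eq_iff.1 hz).resolve_right fun h => by
    have := O.flow_add y
    rw [h] at hzk
    omega
  obtain ⟨m, c', hc', hc'0, hcT⟩ := exists_fundamental_cycle h₂.connected hy₂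
  -- The cycle closed by `y` must come back into `U`, and in `T₂` only `M.opp d` does so. The outer
  -- region on the left of `d` is thus on the right of this cycle.
  obtain ⟨i, hi, his, hit⟩ := hc'.exists_enter (U := U) (by rwa [hc'0]) (by rwa [hc'0])
  have hcd : c' i = M.opp d := by
    refine (M.edge_eq_iff.1 (?_ : M.edge (c' i) = M.edge d)).resolve_left fun h => ?_
    · by_contra hid
      exact his ((hU _ (hcT i hi) hid).2 hit)
    · exact his (h ▸ hsU)
  refine hc'.not_left_and_right (hzc m c' hc' hc'0 hcT) ⟨i, ?_⟩
  rw [hcd, right_opp]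
  exact (SameRegion.symm hl).anti
    (range_edge_subset Set.subset_union_right (Or.inl hy₁) hc'0 hcT)

/-- If the common closure edges connect all the faces other than the root face, every edge of the
second submap belongs to the first. -/
lemma subset_of_sameRegion_union {n : ℕ} {c : Fin (n + 1) → D} (hc : M.IsSimpleCycle c)
    (hroot : ∀ d, M.left d = root ↔ d ∈ Set.range c)
    (h₁ : M.IsSpanningCyclicForest root outer T₁)
    (h : ∀ f, f ≠ root → M.SameRegion (T₁ ∪ T₂) outer f) : T₂ ⊆ T₁ := by
  intro e he₂
  by_contra he₁
  obtain ⟨d, rfl⟩ := M.exists_edge e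
  have hne : ∀ x, M.edge x = M.edge d → M.left x ≠ root := fun x hx h =>
    he₁ (hx ▸ h₁.contour_mem hc hroot x h)
  -- This cycle uses only edges of `T₁ ∪ T₂`, so it separates the two sides of `d`, which `h` joins.
  obtain ⟨m, c', hc', hc0, hcT⟩ := exists_fundamental_cycle h₁.connected he₁
  have hlr := hc'.not_sameRegion (S := T₁ ∪ T₂)
    (range_edge_subset Set.subset_union_left (Or.inr he₂) hc0 hcT) 0
  rw [hc0] at hlr
  exact hlr ((h _ (hne d rfl)).symm.trans (h _ (hne (M.opp d) (M.edge_opp d))))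

end Unique

end PlanarMap

theorem corollary5 {D : Type*} [Finite D] (M : PlanarMap D) (root outer : M.Face)
    (hne : root ≠ outer) (k : ℕ) (hk : 0 < k) (O : M.FracOrientation k)
    (hcircuit : O.ContourIsCircuit root)
    (hmin : O.Minimal outer) (hacc : O.AccessibleOn root Set.univ) :
    ∃! P : Set M.Edge × Set M.Edge, IsCompl P.1 P.2 ∧
      (M.IsSpanningCyclicForest root outer P.1 ∧ O.AccessibleOn root P.1) ∧
      ∀ e ∈ P.2, O.IsClosureEdge outer P.1 e := by
  obtain ⟨X, hX, hXacc, hXcl⟩ := PlanarMap.exists_cyclicForest hne hcircuit hmin hacc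
  obtain ⟨n, c, hc, hroot, -⟩ := hcircuit
  refine ⟨(Xᶜ, X), ⟨isCompl_compl.symm, ⟨hX, hXacc⟩, hXcl⟩, ?_⟩
  rintro ⟨T, C⟩ ⟨hTC, ⟨hT, hTacc⟩, hTcl⟩
  obtain rfl : Tᶜ = C := hTC.compl_eq
  have hunion := PlanarMap.sameRegion_union hc hroot hT hTacc hTcl hX hXacc
    (fun e he => hXcl e (not_not.1 he))
  have h₁ := PlanarMap.subset_of_sameRegion_union hc hroot hT hunion
  have h₂ := PlanarMap.subset_of_sameRegion_union hc hroot hX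
    (fun f hf => by rw [Set.union_comm]; exact hunion f hf)
  obtain rfl : T = Xᶜ := h₂.antisymm h₁
  rw [compl_compl]
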